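/- Let $n,m\ge 1$ and $N\ge 0$ be integers, let $\alpha=(\alpha_1,\dots,\alpha_N)$ and $\beta=(\beta_1,\dots,\beta_N)$ be vectors of integers, and let $\mathbb{Z}_n\times\mathbb{Z}_m$ act diagonally on $\mathbb{C}^N$ by $$(a,b)\cdot(z_1,\dots,z_N)=\bigl(\chi_1(a,b)z_1,\dots,\chi_N(a,b)z_N\bigr),\qquad \chi_k(a,b)=e^{2\pi i a\alpha_k/n}\,e^{2\pi i b\beta_k/m}.$$ Put $$A=\begin{pmatrix}\alpha_1&\cdots&\alpha_N\\ \beta_1&\cdots&\beta_N\end{pmatrix},\qquad P=\begin{pmatrix}n&0\\0&m\end{pmatrix}.$$ Let $V\in\mathbb{Z}^{(N+2)\times(N+2)}$ be unimodular (that is, $\det V=\pm1$) and $H\in\mathbb{Z}^{2\times2}$ be such that $$\begin{pmatrix}A&-P\end{pmatrix}V=\begin{pmatrix}H&0\end{pmatrix}$$ is in column Hermite normal form, i.e. $H$ is upper triangular with positive diagonal entries and $0\le H_{12}<H_{11}$. Write $$V=\begin{pmatrix}V_i&V_n\\P_i&P_n\end{pmatrix},\qquad V_i\in\mathbb{Z}^{N\times2},\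 V_n\in\mathbb{Z}^{N\times N},\ P_i\in\mathbb{Z}^{2\times2},\ P_n\in\mathbb{Z}^{2\times N}$$ (the subscripts $i$ and $n$ are only labels of the blocks), and let $z^{V_n}$ be the $N$-tuple of Laurent monomials whose $j$-th component is $\prod_{k=1}^N z_k^{(V_n)_{kj}}$. Then the $N$ components of $z^{V_n}$ form a minimal generating set of rational invariants: they generate over $\mathbb{C}$ the field $$\{f\in\mathbb{C}(z_1,\dots,z_N) : f(g\cdot z)=f(z)\ \text{for all } g\in\mathbb{Z}_n\times\mathbb{Z}_m\}$$ of rational invariants of the action; no proper subfamily of them generates this field (in particular they are pairwise distinct); and no generating set of this field over $\mathbb{C}$ has fewer than $N$ elements. -/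

import Mathlib

noncomputable section

namespace RationalInvariants

open Matrix

/-- The field `ℂ(z₁, …, z_N)` of rational functions. -/
abbrev RatFun (N : ℕ) : Type := FractionRing (MvPolynomial (Fin N) ℂ)

/-- The coordinate function `z_k`. -/
def coord {N : ℕ} (k : Fin N) : RatFun N :=
  algebraMap (MvPolynomial (Fin N) ℂ) (RatFun N) (MvPolynomial.X k)

/-- The Laurent monomials `z^M`: the component with index `j` is `∏ k, z_k ^ M k j`
(the exponents of one component form a column of `M`). -/
def monomialMap {N : ℕ} {ι : Type*} (M : Matrix (Fin N) ι ℤ) (j : ι) : RatFun N :=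
  ∏ k, coord k ^ M k j

/-! ### The diagonal action -/

/-- The characters of the diagonal action of `ℤ/n × ℤ/m` on `ℂ^N`: the element `(a, b)` multiplies
the `k`-th coordinate by `exp (2πi a α_k / n) * exp (2πi b β_k / m)`.
Here `ZMod.toCircle` is the character `j ↦ exp (2πi j / n)` of `ℤ/n`. -/
def character (n m : ℕ) [NeZero n] [NeZero m] {N : ℕ} (α β : Fin N → ℤ)
    (g : ZMod n × ZMod m) (k : Fin N) : ℂˣ :=
  Circle.toUnits (ZMod.toCircle (g.1 * (α k : ZMod n)) * ZMod.toCircle (g.2 * (β k : ZMod m)))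

/-- Substitution `p(z₁, …, z_N) ↦ p(d₁ z₁, …, d_N z_N)` on polynomials. -/
def polyPullback {N : ℕ} (d : Fin N → ℂˣ) :
    MvPolynomial (Fin N) ℂ ≃ₐ[ℂ] MvPolynomial (Fin N) ℂ :=
  AlgEquiv.ofAlgHom
    (MvPolynomial.aeval fun k => (d k : ℂ) • MvPolynomial.X k)
    (MvPolynomial.aeval fun k => ((d k)⁻¹ : ℂ) • MvPolynomial.X k)
    (by ext1 k; simp [smul_smul])
    (by ext1 k; simp [smul_smul])

/-- Substitution `f(z₁, …, z_N) ↦ f(d₁ z₁, …, d_N z_N)` on rational functions. -/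
def ratPullback {N : ℕ} (d : Fin N → ℂˣ) : RatFun N ≃ₐ[ℂ] RatFun N :=
  IsFractionRing.algEquivOfAlgEquiv (polyPullback d)

/-- The field of rational invariants of the diagonal action of `ℤ/n × ℤ/m`: the rational functions
`f` with `f(g z) = f(z)` for all `g` in the group. -/
def rationalInvariants (n m : ℕ) [NeZero n] [NeZero m] {N : ℕ} (α β : Fin N → ℤ) :
    IntermediateField ℂ (RatFun N) where
  carrier := {f | ∀ g : ZMod n × ZMod m, ratPullback (character n m α β g) f = f}
  mul_mem' hx hy g := by rw [map_mul, hx g, hy g]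
  add_mem' hx hy g := by rw [map_add, hx g, hy g]
  algebraMap_mem' c g := AlgEquiv.commutes _ c
  inv_mem' x hx g := by rw [map_inv₀, hx g]

/-- A family `g` is a minimal generating set of the extension `F` of `ℂ`: it generates `F` as a
field over `ℂ`, no proper subfamily generates `F` (in particular the members of the family are
pairwise distinct), and no generating set of `F` has fewer elements. -/
structure IsMinimalGenerating {N : ℕ} {ι : Type*} (F : IntermediateField ℂ (RatFun N))
    (g : ι → RatFun N) : Prop where
  generates : IntermediateField.adjoin ℂ (Set.range g) = F
  irredundant : ∀ J : Set ι, IntermediateField.adjoin ℂ (g '' J) = F → J = Set.univ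
  card_le : ∀ S : Set (RatFun N), IntermediateField.adjoin ℂ S = F → ENat.card ι ≤ S.encard

/-! ### Hermite multipliers -/

/-- `[H 0]`, with `H` square and nonsingular, is in column Hermite normal form: `H` is upper
triangular with positive diagonal, and in each row the entries to the right of the diagonal are
nonnegative and less than the diagonal entry. -/
structure IsHermite {s : ℕ} (H : Matrix (Fin s) (Fin s) ℤ) : Prop where
  upper : ∀ i j, j < i → H i j = 0
  diag_pos : ∀ i, 0 < H i i
  reduced : ∀ i j, i < j → 0 ≤ H i j ∧ H i j < H i i

/-- `V` is a Hermite multiplier of `[A  -P]`, with Hermite normal form `[H  0]`: an integer matrix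
of determinant `±1` with `[A  -P] * V = [H  0]`. The rows of `V` are split into `N + s`, and its
columns into `s + N`; `Equiv.sumComm` only identifies the two index sets of size `N + s`. -/
structure IsHermiteMultiplier {s N : ℕ} (A : Matrix (Fin s) (Fin N) ℤ)
    (P : Matrix (Fin s) (Fin s) ℤ) (V : Matrix (Fin N ⊕ Fin s) (Fin s ⊕ Fin N) ℤ)
    (H : Matrix (Fin s) (Fin s) ℤ) : Prop where
  unimodular : IsUnit (V.submatrix (Equiv.sumComm (Fin s) (Fin N)) id).det
  mul_eq : fromCols A (-P) * V = fromCols H 0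
  hermite : IsHermite H

/-- The matrix `A` with rows `α` and `β`. -/
def exponentMatrix {N : ℕ} (α β : Fin N → ℤ) : Matrix (Fin 2) (Fin N) ℤ := Matrix.of ![α, β]

/-- The matrix `P = diag(n, m)`. -/
def orderMatrix (n m : ℕ) : Matrix (Fin 2) (Fin 2) ℤ := Matrix.diagonal ![(n : ℤ), (m : ℤ)]

end RationalInvariants

end

namespace RationalInvariants

open Matrix

/-! ### Solutions of the homogeneous system of a Hermite multiplier -/

/-! A Laurent monomial `z^u` is invariant exactly when `A u ∈ P ℤ²`. As `V` is unimodular and `H`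
nonsingular, the kernel of `[A -P]` is spanned by the last `N` columns of `V`, so these `u` form the
column lattice of `V_n` (`exists_mulVec_eq_iff`). Every invariant is a quotient of invariant
polynomials, and these are combinations of invariant monomials; hence `z^{V_n}` generates.
Minimality is a matter of transcendence degree: each `z_k^(nm)` is invariant, so `ℂ(z)` is algebraic
over the field of invariants, and any generating set has at least `N` elements. -/

theorem IsHermite.det_ne_zero {s : ℕ} {H : Matrix (Fin s) (Fin s) ℤ} (hH : IsHermite H) :
    H.det ≠ 0 := by
  rw [Matrix.det_of_isUpperTriangular fun i j hij => hH.upper i j hij]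
  exact Finset.prod_ne_zero_iff.2 fun i _ => (hH.diag_pos i).ne'

theorem IsHermiteMultiplier.exists_mulVec_eq {s N : ℕ} {A : Matrix (Fin s) (Fin N) ℤ}
    {P : Matrix (Fin s) (Fin s) ℤ} {V : Matrix (Fin N ⊕ Fin s) (Fin s ⊕ Fin N) ℤ}
    {H : Matrix (Fin s) (Fin s) ℤ} (hV : IsHermiteMultiplier A P V H) (v : Fin N ⊕ Fin s → ℤ) :
    ∃ y, V *ᵥ y = v := by
  set e := Equiv.sumComm (Fin s) (Fin N)
  refine ⟨(V.submatrix e id)⁻¹ *ᵥ (v ∘ e), ?_⟩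
  have h : V.submatrix e id *ᵥ ((V.submatrix e id)⁻¹ *ᵥ (v ∘ e)) = v ∘ e := by
    rw [mulVec_mulVec, mul_nonsing_inv _ hV.unimodular, one_mulVec]
  exact e.surjective.injective_comp_right h

/-- The columns of `V_n` span the lattice of the `u` with `A u ∈ P ℤ^s`. -/
theorem IsHermiteMultiplier.exists_mulVec_eq_iff {s N : ℕ} {A : Matrix (Fin s) (Fin N) ℤ}
    {P : Matrix (Fin s) (Fin s) ℤ} {V : Matrix (Fin N ⊕ Fin s) (Fin s ⊕ Fin N) ℤ}
    {H : Matrix (Fin s) (Fin s) ℤ} (hV : IsHermiteMultiplier A P V H) (u : Fin N → ℤ) :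
    (∃ w, A *ᵥ u = P *ᵥ w) ↔ ∃ x, V.toBlocks₁₂ *ᵥ x = u := by
  have key (y : Fin s ⊕ Fin N → ℤ) :
      fromCols A (-P) *ᵥ (V *ᵥ y) = H *ᵥ (y ∘ Sum.inl) := by
    rw [mulVec_mulVec, hV.mul_eq, fromCols_mulVec, zero_mulVec, add_zero]
  constructor
  · rintro ⟨w, hw⟩
    obtain ⟨y, hy⟩ := hV.exists_mulVec_eq (Sum.elim u w)
    have h0 : H *ᵥ (y ∘ Sum.inl) = 0 := by
      rw [← key, hy, fromCols_mulVec]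
      simp [hw, neg_mulVec]
    have h1 := eq_zero_of_mulVec_eq_zero hV.hermite.det_ne_zero h0
    refine ⟨y ∘ Sum.inr, ?_⟩
    funext i
    have h2 := congrFun hy (Sum.inl i)
    have h3 (j : Fin s) : y (Sum.inl j) = 0 := congrFun h1 j
    simpa [mulVec, dotProduct, h3, toBlocks₁₂] using h2
  · rintro ⟨x, rfl⟩
    -- The columns `(V_n, P_n)` are killed by `[A -P]`, so `P_n x` is the required `w`.
    refine ⟨V.toBlocks₂₂ *ᵥ x, ?_⟩
    have h := key (Sum.elim 0 x)
    have hc : V *ᵥ Sum.elim 0 x = Sum.elim (V.toBlocks₁₂ *ᵥ x) (V.toBlocks₂₂ *ᵥ x) := by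
      funext i
      rcases i with i | i <;> simp [mulVec, dotProduct, toBlocks₁₂, toBlocks₂₂]
    rw [hc, fromCols_mulVec] at h
    have h0 : (Sum.elim 0 x : Fin s ⊕ Fin N → ℤ) ∘ Sum.inl = 0 := rfl
    rw [h0, mulVec_zero] at h
    simpa [neg_mulVec, add_neg_eq_zero] using h

/-! ### Laurent monomials -/

/-- The Laurent monomial `z^u`. -/
noncomputable def laurentMonomial {N : ℕ} (u : Fin N → ℤ) : RatFun N := ∏ k, coord k ^ u k

theorem coord_ne_zero {N : ℕ} (k : Fin N) : coord k ≠ 0 := by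
  simp [coord, MvPolynomial.X_ne_zero]

theorem laurentMonomial_ne_zero {N : ℕ} (u : Fin N → ℤ) : laurentMonomial u ≠ 0 :=
  Finset.prod_ne_zero_iff.2 fun k _ => zpow_ne_zero _ (coord_ne_zero k)

theorem laurentMonomial_mulVec {N : ℕ} {ι : Type*} [Fintype ι] (M : Matrix (Fin N) ι ℤ)
    (x : ι → ℤ) : laurentMonomial (M *ᵥ x) = ∏ j, monomialMap M j ^ x j := by
  have h (k : Fin N) : coord k ^ (M *ᵥ x) k = ∏ j, (coord k ^ M k j) ^ x j := by
    simp_rw [← _root_.zpow_mul]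
    rw [mulVec, dotProduct]
    induction (Finset.univ : Finset ι) using Finset.cons_induction with
    | empty => simp
    | cons a t ha ih => rw [Finset.sum_cons, zpow_add₀ (coord_ne_zero k), ih, Finset.prod_cons]
  simp_rw [laurentMonomial, h, monomialMap, ← Finset.prod_zpow]
  exact Finset.prod_comm

theorem algebraMap_monomial {N : ℕ} (s : Fin N →₀ ℕ) (c : ℂ) :
    algebraMap (MvPolynomial (Fin N) ℂ) (RatFun N) (MvPolynomial.monomial s c) =
      algebraMap ℂ (RatFun N) c * laurentMonomial fun k => (s k : ℤ) := by
  rw [MvPolynomial.monomial_eq, map_mul, Finsupp.prod_fintype _ _ (by simp), map_prod,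
    IsScalarTower.algebraMap_apply ℂ (MvPolynomial (Fin N) ℂ) (RatFun N)]
  simp [laurentMonomial, coord, MvPolynomial.algebraMap_eq]

/-! ### Diagonal substitutions -/

theorem ratPullback_algebraMap {N : ℕ} (d : Fin N → ℂˣ) (p : MvPolynomial (Fin N) ℂ) :
    ratPullback d (algebraMap _ (RatFun N) p) = algebraMap _ (RatFun N) (polyPullback d p) :=
  IsFractionRing.algEquivOfAlgEquiv_algebraMap _ _

theorem polyPullback_X {N : ℕ} (d : Fin N → ℂˣ) (k : Fin N) :
    polyPullback d (MvPolynomial.X k) = (d k : ℂ) • MvPolynomial.X k := by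
  simp [polyPullback]

theorem polyPullback_monomial {N : ℕ} (d : Fin N → ℂˣ) (s : Fin N →₀ ℕ) (c : ℂ) :
    polyPullback d (MvPolynomial.monomial s c) =
      MvPolynomial.monomial s ((∏ k, (d k : ℂ) ^ s k) * c) := by
  rw [MvPolynomial.monomial_eq, MvPolynomial.monomial_eq, map_mul,
    Finsupp.prod_fintype _ _ (by simp), map_prod, ← MvPolynomial.algebraMap_eq, AlgEquiv.commutes]
  simp_rw [map_pow, polyPullback_X, smul_pow, MvPolynomial.smul_eq_C_mul, Finset.prod_mul_distrib,
    MvPolynomial.algebraMap_eq, map_mul, map_prod, map_pow]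
  ring

/-- Monomials are eigenvectors, so composition and invariance reduce to scalar identities, one per
coefficient. -/
theorem coeff_polyPullback {N : ℕ} (d : Fin N → ℂˣ) (p : MvPolynomial (Fin N) ℂ)
    (s : Fin N →₀ ℕ) :
    (polyPullback d p).coeff s = (∏ k, (d k : ℂ) ^ s k) * p.coeff s := by
  induction p using MvPolynomial.induction_on' with
  | monomial t c =>
    rw [polyPullback_monomial, MvPolynomial.coeff_monomial, MvPolynomial.coeff_monomial]
    split_ifs with h
    · rw [h]
    · rw [mul_zero]
  | add p q hp hq => rw [map_add, MvPolynomial.coeff_add, hp, hq, MvPolynomial.coeff_add, mul_add]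

theorem polyPullback_mul {N : ℕ} (d e : Fin N → ℂˣ) (p : MvPolynomial (Fin N) ℂ) :
    polyPullback (d * e) p = polyPullback d (polyPullback e p) := by
  ext s
  simp [coeff_polyPullback, mul_pow, Finset.prod_mul_distrib, mul_assoc]

theorem polyPullback_one {N : ℕ} (p : MvPolynomial (Fin N) ℂ) : polyPullback 1 p = p := by
  ext s
  simp [coeff_polyPullback]

theorem ratPullback_laurentMonomial {N : ℕ} (d : Fin N → ℂˣ) (u : Fin N → ℤ) :
    ratPullback d (laurentMonomial u) =
      algebraMap ℂ (RatFun N) ((∏ k, d k ^ u k : ℂˣ) : ℂ) * laurentMonomial u := by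
  have h (k : Fin N) : ratPullback d (coord k) = algebraMap ℂ (RatFun N) (d k) * coord k := by
    rw [coord, ratPullback_algebraMap, polyPullback_X, Algebra.smul_def, map_mul,
      ← IsScalarTower.algebraMap_apply]
  simp only [laurentMonomial, map_prod, map_zpow₀, h, mul_zpow, Finset.prod_mul_distrib,
    Units.coe_prod, Units.val_zpow_eq_zpow_val]

/-! ### The characters -/

theorem addChar_map_sum {ι A M : Type*} [AddCommMonoid A] [CommMonoid M]
    (ψ : AddChar A M) (t : Finset ι) (a : ι → A) : ψ (∑ i ∈ t, a i) = ∏ i ∈ t, ψ (a i) :=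
  map_prod ψ.toMonoidHom (fun i => Multiplicative.ofAdd (a i)) t

theorem exists_exponentMatrix_mulVec_eq_iff (n m : ℕ) {N : ℕ} (α β : Fin N → ℤ)
    (u : Fin N → ℤ) :
    (∃ w, exponentMatrix α β *ᵥ u = orderMatrix n m *ᵥ w) ↔
      (n : ℤ) ∣ α ⬝ᵥ u ∧ (m : ℤ) ∣ β ⬝ᵥ u := by
  constructor
  · rintro ⟨w, hw⟩
    have h0 := congrFun hw 0
    have h1 := congrFun hw 1
    simp only [orderMatrix, mulVec_diagonal] at h0 h1
    exact ⟨⟨w 0, h0⟩, ⟨w 1, h1⟩⟩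
  · rintro ⟨⟨a, ha⟩, ⟨b, hb⟩⟩
    refine ⟨![a, b], ?_⟩
    funext i
    rw [orderMatrix, mulVec_diagonal]
    fin_cases i
    · exact ha
    · exact hb

section Character

variable (n m : ℕ) [NeZero n] [NeZero m] {N : ℕ} (α β : Fin N → ℤ)

theorem character_zero : character n m α β 0 = 1 := by
  funext k
  simp [character]

theorem character_add (g h : ZMod n × ZMod m) :
    character n m α β (g + h) = character n m α β g * character n m α β h := by
  funext k
  rw [Pi.mul_apply, character, character, character, ← map_mul]
  congr 1
  rw [Prod.fst_add, Prod.snd_add, add_mul, add_mul, AddChar.map_add_eq_mul,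
    AddChar.map_add_eq_mul, mul_mul_mul_comm]

theorem prod_character_zpow (g : ZMod n × ZMod m) (u : Fin N → ℤ) :
    ∏ k, character n m α β g k ^ u k =
      Circle.toUnits (ZMod.toCircle (g.1 * ((α ⬝ᵥ u : ℤ) : ZMod n)) *
        ZMod.toCircle (g.2 * ((β ⬝ᵥ u : ℤ) : ZMod m))) := by
  simp_rw [character, ← map_zpow, ← map_prod, mul_zpow, ← AddChar.map_zsmul_eq_zpow,
    Finset.prod_mul_distrib, ← addChar_map_sum]
  congr 4 <;> simp [dotProduct, Finset.mul_sum] <;>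
    exact Finset.sum_congr rfl fun k _ => by ring

theorem prod_character_zpow_eq_one_iff (u : Fin N → ℤ) :
    (∀ g, ∏ k, character n m α β g k ^ u k = 1) ↔ (n : ℤ) ∣ α ⬝ᵥ u ∧ (m : ℤ) ∣ β ⬝ᵥ u := by
  have hinj : Function.Injective Circle.toUnits := fun x y h =>
    Circle.ext (by simpa using congrArg Units.val h)
  simp_rw [prod_character_zpow, map_eq_one_iff _ hinj, ← ZMod.intCast_zmod_eq_zero_iff_dvd]
  constructor
  · intro h
    constructor
    -- The elements `(1, 0)` and `(0, 1)` isolate the two congruences.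
    · exact ZMod.injective_toCircle (by simpa using h (1, 0))
    · exact ZMod.injective_toCircle (by simpa using h (0, 1))
  · rintro ⟨h1, h2⟩ g
    simp [h1, h2]

theorem laurentMonomial_mem_rationalInvariants_iff (u : Fin N → ℤ) :
    laurentMonomial u ∈ rationalInvariants n m α β ↔
      (n : ℤ) ∣ α ⬝ᵥ u ∧ (m : ℤ) ∣ β ⬝ᵥ u := by
  rw [← prod_character_zpow_eq_one_iff]
  refine forall_congr' fun g => ?_
  rw [ratPullback_laurentMonomial, mul_eq_right₀ (laurentMonomial_ne_zero u),
    map_eq_one_iff _ (algebraMap ℂ (RatFun N)).injective, Units.val_eq_one]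

/-! ### The field of invariants -/

/-- An invariant rational function is a quotient of invariant polynomials. -/
theorem exists_invariant_div {f : RatFun N} (hf : f ∈ rationalInvariants n m α β) :
    ∃ p q : MvPolynomial (Fin N) ℂ,
      (∀ g, polyPullback (character n m α β g) p = p) ∧
      (∀ g, polyPullback (character n m α β g) q = q) ∧
      f = algebraMap _ (RatFun N) p / algebraMap _ (RatFun N) q := by
  obtain ⟨p, q, hq, rfl⟩ := IsFractionRing.div_surjective (MvPolynomial (Fin N) ℂ) f
  have hq0 : q ≠ 0 := nonZeroDivisors.ne_zero hq
  set c := character n m α β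
  -- Expanding the fraction by `R` turns the denominator into the norm `Q` of `q` over the group;
  -- the numerator `f * Q` is then invariant too.
  set Q := ∏ g, polyPullback (c g) q with hQ
  have hQinv (h : ZMod n × ZMod m) : polyPullback (c h) Q = Q := by
    rw [hQ, map_prod]
    simp_rw [← polyPullback_mul, c, ← character_add]
    exact Fintype.prod_equiv (Equiv.addLeft h) _ _ fun _ => rfl
  have hQ0 : Q ≠ 0 := Finset.prod_ne_zero_iff.2 fun g _ => by simpa using hq0
  set R := ∏ g ∈ Finset.univ.erase 0, polyPullback (c g) q
  have hQR : Q = q * R := by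
    rw [hQ, ← Finset.mul_prod_erase _ _ (Finset.mem_univ 0)]
    simp only [c, character_zero, polyPullback_one]
    rfl
  have hinj := IsFractionRing.injective (MvPolynomial (Fin N) ℂ) (RatFun N)
  have hqm : algebraMap _ (RatFun N) q ≠ 0 := by simpa using hq0
  have hQm : algebraMap _ (RatFun N) Q ≠ 0 := by simpa using hQ0
  have hfQ : algebraMap _ (RatFun N) p / algebraMap _ (RatFun N) q =
      algebraMap _ (RatFun N) (p * R) / algebraMap _ (RatFun N) Q := by
    rw [div_eq_div_iff hqm hQm, ← map_mul, ← map_mul, hQR]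
    ring_nf
  refine ⟨p * R, Q, fun g => hinj ?_, hQinv, hfQ⟩
  have h := hf g
  rw [hfQ, map_div₀, ratPullback_algebraMap, ratPullback_algebraMap, hQinv] at h
  exact (div_left_inj' hQm).1 h

/-- A monomial with nonzero coefficient in an invariant polynomial must have eigenvalue 1 under
every `g`. -/
theorem algebraMap_mem_of_invariant {K : IntermediateField ℂ (RatFun N)}
    (hK : ∀ u, laurentMonomial u ∈ rationalInvariants n m α β → laurentMonomial u ∈ K)
    {p : MvPolynomial (Fin N) ℂ} (hp : ∀ g, polyPullback (character n m α β g) p = p) :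
    algebraMap _ (RatFun N) p ∈ K := by
  rw [p.as_sum, map_sum]
  refine sum_mem fun s hs => ?_
  rw [algebraMap_monomial]
  refine mul_mem (K.algebraMap_mem _) (hK _ ?_)
  rw [laurentMonomial_mem_rationalInvariants_iff, ← prod_character_zpow_eq_one_iff]
  intro g
  have h := coeff_polyPullback (character n m α β g) p s
  rw [hp g, eq_comm, mul_eq_right₀ (MvPolynomial.mem_support_iff.1 hs)] at h
  ext
  simpa using h

/-- The field of rational invariants is generated by the Laurent monomials in it. -/
theorem rationalInvariants_le {K : IntermediateField ℂ (RatFun N)}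
    (hK : ∀ u, laurentMonomial u ∈ rationalInvariants n m α β → laurentMonomial u ∈ K) :
    rationalInvariants n m α β ≤ K := by
  intro f hf
  obtain ⟨p, q, hp, hq, rfl⟩ := exists_invariant_div n m α β hf
  exact div_mem (algebraMap_mem_of_invariant n m α β hK hp)
    (algebraMap_mem_of_invariant n m α β hK hq)

theorem adjoin_monomialMap_eq {V : Matrix (Fin N ⊕ Fin 2) (Fin 2 ⊕ Fin N) ℤ}
    {H : Matrix (Fin 2) (Fin 2) ℤ}
    (hV : IsHermiteMultiplier (exponentMatrix α β) (orderMatrix n m) V H) :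
    IntermediateField.adjoin ℂ (Set.range (monomialMap V.toBlocks₁₂)) =
      rationalInvariants n m α β := by
  have hmem (u : Fin N → ℤ) :
      laurentMonomial u ∈ rationalInvariants n m α β ↔ ∃ x, V.toBlocks₁₂ *ᵥ x = u := by
    rw [laurentMonomial_mem_rationalInvariants_iff, ← exists_exponentMatrix_mulVec_eq_iff,
      hV.exists_mulVec_eq_iff]
  apply le_antisymm
  · rw [IntermediateField.adjoin_le_iff]
    rintro _ ⟨j, rfl⟩
    exact (hmem fun k => V.toBlocks₁₂ k j).2
      ⟨Pi.single j 1, by rw [mulVec_single_one]; rfl⟩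
  · refine rationalInvariants_le n m α β fun u hu => ?_
    obtain ⟨x, rfl⟩ := (hmem u).1 hu
    rw [laurentMonomial_mulVec]
    exact prod_mem fun j _ => zpow_mem (IntermediateField.subset_adjoin _ _ (Set.mem_range_self j)) _

/-! ### The number of generators -/

theorem coord_pow_mem_rationalInvariants (k : Fin N) :
    coord k ^ (n * m) ∈ rationalInvariants n m α β := by
  have h : coord k ^ (n * m) = laurentMonomial (Pi.single k ((n * m : ℕ) : ℤ)) := by
    rw [laurentMonomial, Fintype.prod_eq_single k fun i hi => by simp [hi], Pi.single_eq_same,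
      zpow_natCast]
  rw [h, laurentMonomial_mem_rationalInvariants_iff, dotProduct_single, dotProduct_single]
  push_cast
  exact ⟨⟨α k * m, by ring⟩, ⟨β k * n, by ring⟩⟩

theorem isTranscendenceBasis_coord (N : ℕ) :
    IsTranscendenceBasis ℂ (coord : Fin N → RatFun N) := by
  have : Algebra.IsAlgebraic (MvPolynomial (Fin N) ℂ) (RatFun N) :=
    IsLocalization.isAlgebraic _ (nonZeroDivisors (MvPolynomial (Fin N) ℂ))
  exact (IsTranscendenceBasis.mvPolynomial (Fin N) ℂ).algebraMap_comp

theorem isAlgebraic_rationalInvariants :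
    Algebra.IsAlgebraic (rationalInvariants n m α β) (RatFun N) := by
  refine (isTranscendenceBasis_coord N).isAlgebraic_iff.2 fun k => ?_
  refine IsAlgebraic.of_pow (n := n * m) (Nat.pos_of_neZero _) ?_
  exact isAlgebraic_algebraMap
    (⟨_, coord_pow_mem_rationalInvariants n m α β k⟩ : rationalInvariants n m α β)

open scoped IntermediateField.algebraAdjoinAdjoin in
theorem le_encard_of_isAlgebraic_adjoin (S : Set (RatFun N))
    [Algebra.IsAlgebraic (IntermediateField.adjoin ℂ S) (RatFun N)] : (N : ℕ∞) ≤ S.encard := by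
  -- The field generated by `S` is the fraction field of `ℂ[S]`, hence algebraic over it; so `S`
  -- bounds the transcendence degree `N`.
  have : Algebra.IsAlgebraic (Algebra.adjoin ℂ S) (RatFun N) :=
    .trans _ (IntermediateField.adjoin ℂ S) _
  have h := Algebra.IsAlgebraic.trdeg_le_cardinalMk ℂ S
  have hN : Algebra.trdeg ℂ (RatFun N) = N := by
    rw [← Cardinal.lift_id (Algebra.trdeg ℂ (RatFun N)),
      ← (isTranscendenceBasis_coord N).lift_cardinalMk_eq_trdeg, Cardinal.mk_fin,
      Cardinal.lift_natCast]
  rw [hN] at h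
  exact (map_natCast Cardinal.toENat N).symm.le.trans (OrderHomClass.mono Cardinal.toENat h)

theorem le_encard_of_adjoin_eq_rationalInvariants {S : Set (RatFun N)}
    (hS : IntermediateField.adjoin ℂ S = rationalInvariants n m α β) : (N : ℕ∞) ≤ S.encard := by
  have := isAlgebraic_rationalInvariants n m α β
  rw [← hS] at this
  exact le_encard_of_isAlgebraic_adjoin S

end Character

end RationalInvariants

theorem mainTheorem12 (n m N : ℕ) [NeZero n] [NeZero m] (α β : Fin N → ℤ)
    (V : Matrix (Fin N ⊕ Fin 2) (Fin 2 ⊕ Fin N) ℤ) (H : Matrix (Fin 2) (Fin 2) ℤ)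
    (hV : RationalInvariants.IsHermiteMultiplier (RationalInvariants.exponentMatrix α β)
      (RationalInvariants.orderMatrix n m) V H) :
    RationalInvariants.IsMinimalGenerating (RationalInvariants.rationalInvariants n m α β)
      (RationalInvariants.monomialMap V.toBlocks₁₂) where
  generates := RationalInvariants.adjoin_monomialMap_eq n m α β hV
  irredundant J hJ := by
    -- A generating subfamily has at least `N` distinct values, so at least `N` indices, hence all
    -- of them.
    have h := (RationalInvariants.le_encard_of_adjoin_eq_rationalInvariants n m α β hJ).trans
      (Set.encard_image_le _ J)
    refine Set.Finite.eq_of_subset_of_encard_le J.toFinite (Set.subset_univ J) ?_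
    simpa [Set.encard_univ] using h
  card_le S hS := by
    simpa using RationalInvariants.le_encard_of_adjoin_eq_rationalInvariants n m α β hS
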